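/- Let $\mathcal{E}$ be the elliptic curve $y^2=x(x+1)(x+T^2)$ over the rational function field $\mathbb{Q}(T)$. Its Mordell–Weil group $\mathcal{E}(\mathbb{Q}(T))$ is isomorphic to $\mathbb{Z}/2\mathbb{Z}\times\mathbb{Z}/4\mathbb{Z}$, and it consists exactly of the eight points $$O,\quad (0,0),\quad (-1,0),\quad (-T^2,0),\quad (-T,\,\pm T(T-1)),\quad (T,\,\pm T(T+1)),$$ where $O$ is the point at infinity. -/

import Mathlib

open scoped RatFunc

noncomputable section

namespace MordellWeilFamily

/-- The rational function field `ℚ(T)`. -/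
abbrev K : Type := RatFunc ℚ

/-- The indeterminate `T` of `ℚ(T)`. -/
abbrev T : K := RatFunc.X

/-- The Weierstrass curve `y² = x³ + (1 + T²) x² + T² x`, that is `y² = x (x + 1) (x + T²)`,
over `ℚ(T)`. -/
def E : WeierstrassCurve K where
  a₁ := 0
  a₂ := 1 + T ^ 2
  a₃ := 0
  a₄ := T ^ 2
  a₆ := 0

lemma equation_iff (x y : K) :
    E.toAffine.Equation x y ↔ y ^ 2 = x * (x + 1) * (x + T ^ 2) := by
  rw [WeierstrassCurve.Affine.equation_iff]
  simp only [E]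
  constructor <;> intro h <;> linear_combination h

lemma discriminant_eq : E.Δ = 16 * T ^ 4 * (T - 1) ^ 2 * (T + 1) ^ 2 := by
  simp only [WeierstrassCurve.Δ, WeierstrassCurve.b₂, WeierstrassCurve.b₄, WeierstrassCurve.b₆,
    WeierstrassCurve.b₈, E]
  ring

lemma T_add_C_ne_zero (c : ℚ) : T + RatFunc.C c ≠ 0 := by
  have h : T + RatFunc.C c = algebraMap (Polynomial ℚ) K (Polynomial.X + Polynomial.C c) := by
    simp
  rw [h]
  exact RatFunc.algebraMap_ne_zero (Polynomial.X_add_C_ne_zero c)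

/-- The curve is an elliptic curve: its discriminant does not vanish. -/
instance isElliptic : E.IsElliptic where
  isUnit := by
    rw [discriminant_eq, isUnit_iff_ne_zero]
    have h0 : T ≠ 0 := RatFunc.X_ne_zero
    have h1 : T - 1 ≠ 0 := by simpa [sub_eq_add_neg] using T_add_C_ne_zero (-1)
    have h2 : T + 1 ≠ 0 := by simpa using T_add_C_ne_zero 1
    exact mul_ne_zero (mul_ne_zero (mul_ne_zero (by norm_num) (pow_ne_zero _ h0))
      (pow_ne_zero _ h1)) (pow_ne_zero _ h2)

/-- The affine `ℚ(T)`-point `(x, y)` of the curve. -/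
def pt (x y : K) (h : y ^ 2 = x * (x + 1) * (x + T ^ 2)) : E.toAffine.Point :=
  .some x y (E.toAffine.equation_iff_nonsingular.mp ((equation_iff x y).mpr h))

/-- The eight points `O`, `(0, 0)`, `(-1, 0)`, `(-T², 0)`, `(-T, ±T(T - 1))`, `(T, ±T(T + 1))`. -/
def eightPoints : Set E.toAffine.Point :=
  {0,
   pt (-T) (-(T * (T - 1))) (by ring),
   pt 0 0 (by ring),
   pt (-T) (T * (T - 1)) (by ring),
   pt (-1) 0 (by ring),
   pt T (-(T * (T + 1))) (by ring),
   pt (-T ^ 2) 0 (by ring),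
   pt T (T * (T + 1)) (by ring)}

end MordellWeilFamily

end

/-!
Let `P = (x, y)` be a rational point with `y ≠ 0`. The duplication formula shows that `x(2P)`,
`x(2P) + 1` and `x(2P) + T²` are all squares; explicitly `x(2P) = w²` with `w = (x² - T²) / (2y)`.
So the whole theorem reduces to the claim that `w = 0` is the only `w ∈ ℚ(T)` for which `w² + 1` and
`w² + T²` are squares (`eq_zero_of_sq_add_eq_sq`): then `x = ±T`, while `y = 0` gives the points of
order 2. No height function and no group law enter this part.

For the claim, write `w = r / e` in lowest terms. Then `r² + e²` and `r² + X²e²` are squares of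
polynomials, and this is impossible for coprime nonzero `r`, `e`, even with coefficients in an
algebraically closed field (`not_sq_add_sq_of_isCoprime`). The proof is Fermat's infinite descent on
`deg r + deg e`. If `X ∣ r`, replacing `(r, e)` by `(e, r / X)` lowers the sum by one. Otherwise both
equations are parametrised like Pythagorean triples, `e = m n = u v` with
`2r = n² - m² = v² - X²u²`. A common refinement `m = αβ`, `n = γδ`, `u = αγ`, `v = βδ` gives
`γ² - β² = α² f` and `β² - X²γ² = δ² f` with `f ∣ X² - 1`. Comparing degrees modulo 2 excludes
`deg f = 1`, and the two remaining values of `f` (up to constants, which are squares) make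
`(iβ, γ)` or `(δ, α)` a solution with degree sum at most `deg e < deg r + deg e`.

The group structure then follows from `2 (T, T(T + 1)) = (0, 0)`, which makes `(T, T(T + 1))` of
order 4 and `(-1, 0)` an element of order 2 outside the subgroup that it generates.
-/

open Polynomial

/-! ### Squares of polynomials over an algebraically closed field -/

section Descent

variable {k : Type*} [Field k]

/-- Over an algebraically closed field, coprime factors of a square in `k[X]` are squares: the
unit left over by unique factorisation is a constant, hence itself a square. -/
lemma exists_eq_sq_of_isCoprime_of_mul_eq_sq [IsAlgClosed k] {a b c : k[X]} (hab : IsCoprime a b)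
    (h : a * b = c ^ 2) : ∃ d, a = d ^ 2 := by
  obtain ⟨d, u, hu⟩ := exists_associated_pow_of_mul_eq_pow' hab h
  obtain ⟨z, -, hz⟩ := Polynomial.isUnit_iff.mp u.isUnit
  obtain ⟨y, hy⟩ := IsAlgClosed.exists_pow_nat_eq z two_pos
  exact ⟨d * C y, by rw [← hu, ← hz, ← hy, C_pow, mul_pow]⟩

/-- Parametrisation of Pythagorean triples over an algebraically closed field: `t - r` and `t + r`
are coprime with product `c²`, hence squares `p²` and `q²`. -/
lemma exists_parametrization_of_sq_add_sq [IsAlgClosed k] [NeZero (2 : k)] {r c t : k[X]}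
    (hrc : IsCoprime r c) (h : r ^ 2 + c ^ 2 = t ^ 2) :
    ∃ p q, IsCoprime p q ∧ 2 * r = q ^ 2 - p ^ 2 ∧ c = p * q := by
  have h2 : IsUnit (2 : k[X]) :=
    isUnit_C.mpr (isUnit_iff_ne_zero.mpr (two_ne_zero (α := k)))
  have hrt : IsCoprime r t := by
    have h1 : IsCoprime r (t ^ 2) := by
      rw [← h, add_comm, pow_two r, IsCoprime.add_mul_left_right_iff]
      exact hrc.pow_right
    exact h1.of_isCoprime_of_dvd_right (dvd_pow_self t two_ne_zero)
  have hco : IsCoprime (t - r) (t + r) := by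
    have h1 : IsCoprime (t - r) (2 * r) := by
      refine IsCoprime.mul_right (isCoprime_one_right.of_isCoprime_of_dvd_right h2.dvd) ?_
      simpa [sub_eq_add_neg] using (hrt.symm.add_mul_left_left (-1))
    have h3 : t + r = 2 * r + (t - r) * 1 := by ring
    rw [h3]
    exact h1.add_mul_left_right 1
  have hmul : (t - r) * (t + r) = c ^ 2 := by linear_combination -h
  obtain ⟨p, hp⟩ := exists_eq_sq_of_isCoprime_of_mul_eq_sq hco hmul
  obtain ⟨q, hq⟩ := exists_eq_sq_of_isCoprime_of_mul_eq_sq hco.symm (by rw [mul_comm]; exact hmul)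
  have hcop : IsCoprime p q := by
    rw [← IsCoprime.pow_iff two_pos two_pos, ← hp, ← hq]
    exact hco
  have hpq : c ^ 2 = (p * q) ^ 2 := by rw [mul_pow, ← hp, ← hq, hmul]
  rcases sq_eq_sq_iff_eq_or_eq_neg.mp hpq with h' | h'
  · exact ⟨p, q, hcop, by rw [← hp, ← hq]; ring, h'⟩
  · exact ⟨-p, q, hcop.neg_left, by rw [neg_sq, ← hp, ← hq]; ring, by rw [h']; ring⟩

/-- A divisor of odd degree of `γ² - β²` and of `β² - X²γ²`, with square cofactors, is excluded by
comparing degrees: the first forces `deg β = deg γ`, and then the second has even degree. -/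
lemma not_odd_natDegree_of_sq_mul {α β γ δ f : k[X]} (hα : α ≠ 0) (hγ : γ ≠ 0) (hδ : δ ≠ 0)
    (h₁ : γ ^ 2 - β ^ 2 = α ^ 2 * f) (h₂ : β ^ 2 - X ^ 2 * γ ^ 2 = δ ^ 2 * f) :
    ¬ Odd f.natDegree := by
  intro hf
  have hf0 : f ≠ 0 := by rintro rfl; simp at hf
  have odd_of {a g : k[X]} (ha : a ≠ 0) (h : g = a ^ 2 * f) : Odd g.natDegree := by
    rw [h, natDegree_mul (pow_ne_zero 2 ha) hf0, natDegree_pow]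
    exact (even_two_mul _).add_odd hf
  have o₁ := odd_of hα h₁
  have o₂ := odd_of hδ h₂
  have hdeg : (X ^ 2 * γ ^ 2 : k[X]).natDegree = 2 + 2 * γ.natDegree := by
    rw [natDegree_mul (pow_ne_zero 2 X_ne_zero) (pow_ne_zero 2 hγ), natDegree_pow, natDegree_pow,
      natDegree_X]
  rcases lt_trichotomy γ.natDegree β.natDegree with h | h | h
  · rw [natDegree_sub_eq_right_of_natDegree_lt (by simpa using h), natDegree_pow] at o₁
    exact Nat.not_odd_iff_even.mpr (even_two_mul _) o₁
  · rw [natDegree_sub_eq_right_of_natDegree_lt (by rw [hdeg, natDegree_pow]; lia), hdeg] at o₂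
    exact Nat.not_odd_iff_even.mpr (even_two.add (even_two_mul _)) o₂
  · rw [natDegree_sub_eq_left_of_natDegree_lt (by simpa using h), natDegree_pow] at o₁
    exact Nat.not_odd_iff_even.mpr (even_two_mul _) o₁

/-- If `r` is a unit, then so are `t ± X e`, and their difference `2 X e` is constant, which forces
`e = 0`. -/
lemma not_isUnit_of_sq_add_sq [NeZero (2 : k)] {r e t : k[X]} (he : e ≠ 0)
    (ht : r ^ 2 + X ^ 2 * e ^ 2 = t ^ 2) : ¬ IsUnit r := by
  intro hr
  have h2 : (2 : k[X]) = C 2 := rfl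
  have hu : IsUnit ((t - X * e) * (t + X * e)) := by
    rw [show (t - X * e) * (t + X * e) = r ^ 2 by linear_combination -ht]
    exact hr.pow 2
  have d₁ := natDegree_eq_zero_of_isUnit (isUnit_of_mul_isUnit_left hu)
  have d₂ := natDegree_eq_zero_of_isUnit (isUnit_of_mul_isUnit_right hu)
  have h3 : (C 2 * (X * e)).natDegree = 0 := by
    rw [show C 2 * (X * e) = (t + X * e) - (t - X * e) by rw [← h2]; ring]
    exact Nat.le_zero.mp ((natDegree_sub_le _ _).trans (by rw [d₁, d₂]; rfl))
  rw [natDegree_C_mul (two_ne_zero (α := k)), natDegree_X_mul he] at h3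
  lia

/-- A divisor of `X² - 1` is a constant, has degree one, or is a constant multiple of `X² - 1`;
over an algebraically closed field the constants may be written as squares. -/
lemma dvd_X_sq_sub_one_cases [IsAlgClosed k] {f : k[X]} (hf : f ∣ X ^ 2 - 1) :
    f.natDegree = 1 ∨ ∃ d : k, d ≠ 0 ∧ (f = C d ^ 2 ∨ f = C d ^ 2 * (X ^ 2 - 1)) := by
  obtain ⟨g, hg⟩ := hf
  have hdeg : (X ^ 2 - 1 : k[X]).natDegree = 2 := natDegree_X_pow_sub_C (r := (1 : k))
  have h0 : (X ^ 2 - 1 : k[X]) ≠ 0 := by intro h; rw [h] at hdeg; simp at hdeg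
  have hf0 : f ≠ 0 := by rintro rfl; exact h0 (by rw [hg, zero_mul])
  have hg0 : g ≠ 0 := by rintro rfl; exact h0 (by rw [hg, mul_zero])
  rw [hg, natDegree_mul hf0 hg0] at hdeg
  have hsq : ∀ z : k, z ≠ 0 → ∃ y : k, y ≠ 0 ∧ y ^ 2 = z := fun z hz => by
    obtain ⟨y, hy⟩ := IsAlgClosed.exists_pow_nat_eq z two_pos
    exact ⟨y, by rintro rfl; exact hz (by rw [← hy]; simp), hy⟩
  rcases (by lia : f.natDegree = 0 ∨ f.natDegree = 1 ∨ g.natDegree = 0) with h | h | h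
  · rw [natDegree_eq_zero] at h
    obtain ⟨z, rfl⟩ := h
    obtain ⟨y, hy0, rfl⟩ := hsq z (by rintro rfl; simp at hf0)
    exact .inr ⟨y, hy0, .inl (C_pow)⟩
  · exact .inl h
  · rw [natDegree_eq_zero] at h
    obtain ⟨z, rfl⟩ := h
    have hz : z ≠ 0 := by rintro rfl; simp at hg0
    obtain ⟨y, hy0, hy⟩ := hsq z⁻¹ (inv_ne_zero hz)
    refine .inr ⟨y, hy0, .inr ?_⟩
    rw [hg, ← C_pow, hy, mul_comm f, ← mul_assoc, ← C_mul, inv_mul_cancel₀ hz, C_1, one_mul]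

/-! ### The descent -/

/-- A solution gives the point `(r² / e², r s t / e³)` of `y² = x (x + 1) (x + X²)`. If `X ∤ r`, the
descent step replaces it by one of its halves; otherwise it adds the point `(0, 0)`. -/
theorem not_sq_add_sq_of_isCoprime [IsAlgClosed k] [NeZero (2 : k)] {r e s t : k[X]}
    (hre : IsCoprime r e) (hr : r ≠ 0) (he : e ≠ 0)
    (hs : r ^ 2 + e ^ 2 = s ^ 2) (ht : r ^ 2 + X ^ 2 * e ^ 2 = t ^ 2) : False := by
  induction hN : r.natDegree + e.natDegree using Nat.strong_induction_on generalizing r e s t with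
  | _ N ih =>
  have hrdeg : 0 < r.natDegree :=
    natDegree_pos_iff_degree_pos.mpr
      (degree_pos_of_ne_zero_of_nonunit hr (not_isUnit_of_sq_add_sq he ht))
  by_cases hX : X ∣ r
  · -- Adding the 2-torsion point `(0, 0)` to the point with `x = (r / e)²` replaces `x` by `X² / x`.
    obtain ⟨r₁, rfl⟩ := hX
    have hr₁ : r₁ ≠ 0 := right_ne_zero_of_mul hr
    obtain ⟨t₁, rfl⟩ : X ∣ t := prime_X.dvd_of_dvd_pow (n := 2)
      (by rw [← ht]; exact ⟨X * (r₁ ^ 2 + e ^ 2), by ring⟩)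
    refine ih _ ?_ hre.of_mul_left_right.symm he hr₁ (s := t₁) (t := s) ?_ ?_ rfl
    · rw [← hN, natDegree_X_mul hr₁]; lia
    · refine mul_left_cancel₀ (pow_ne_zero 2 (X_ne_zero (R := k))) ?_
      linear_combination ht
    · linear_combination hs
  obtain ⟨i, hi⟩ := IsAlgClosed.exists_pow_nat_eq (-1 : k) two_pos
  have hI : (C i : k[X]) ^ 2 = -1 := by rw [← C_pow, hi]; simp
  have hI0 : IsUnit (C i : k[X]) := isUnit_C.mpr (isUnit_iff_ne_zero.mpr (by rintro rfl; simp at hi))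
  have hrX : IsCoprime r X := ((irreducible_X.coprime_iff_not_dvd).mpr hX).symm
  obtain ⟨m, n, hcop, hmn, hemn⟩ := exists_parametrization_of_sq_add_sq hre hs
  -- `X` divides one of the two parameters of `r ^ 2 + (X * e) ^ 2 = t ^ 2`; changing the sign of `t`
  -- exchanges them up to the factor `i`.
  obtain ⟨u, v, hcop', huv, heuv⟩ :
      ∃ u v, IsCoprime u v ∧ 2 * r = v ^ 2 - X ^ 2 * u ^ 2 ∧ e = u * v := by
    obtain ⟨p, q, hc, hpq, hepq⟩ := exists_parametrization_of_sq_add_sq (c := X * e) (t := t)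
      (hrX.mul_right hre) (by rw [mul_pow]; exact ht)
    rcases prime_X.dvd_or_dvd (Dvd.intro _ hepq) with ⟨u, rfl⟩ | ⟨u, rfl⟩
    · exact ⟨u, q, hc.of_mul_left_right, by rw [hpq]; ring,
        mul_left_cancel₀ X_ne_zero (by rw [hepq]; ring)⟩
    · refine ⟨-(C i * u), C i * p, ?_, by rw [hpq]; linear_combination (X ^ 2 * u ^ 2 - p ^ 2) * hI,
        mul_left_cancel₀ X_ne_zero (by rw [hepq]; linear_combination (X * u * p) * hI)⟩
      exact ((isCoprime_mul_unit_left hI0 u p).mpr hc.of_mul_right_right.symm).neg_left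
  -- A common refinement of the two factorisations `e = m * n = u * v`.
  obtain ⟨α, β, ⟨γ, rfl⟩, ⟨δ, rfl⟩, rfl⟩ :=
    exists_dvd_and_dvd_of_dvd_mul (Dvd.intro n (hemn.symm.trans heuv))
  have hα : α ≠ 0 := by rintro rfl; simp [heuv] at he
  have hβ : β ≠ 0 := by rintro rfl; simp [heuv] at he
  have hγ : γ ≠ 0 := by rintro rfl; simp [heuv] at he
  have hδ : δ ≠ 0 := by rintro rfl; simp [heuv] at he
  obtain rfl : n = γ * δ := mul_left_cancel₀ (mul_ne_zero hα hβ) (by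
    rw [← hemn, heuv]; ring)
  have hαδ : IsCoprime α δ := hcop.of_mul_left_left.of_mul_right_right
  have hγβ : IsCoprime γ β := hcop'.of_mul_left_right.of_mul_right_left
  have key : δ ^ 2 * (γ ^ 2 - β ^ 2) = α ^ 2 * (β ^ 2 - X ^ 2 * γ ^ 2) := by
    linear_combination huv - hmn
  obtain ⟨f, h₁⟩ : α ^ 2 ∣ γ ^ 2 - β ^ 2 := hαδ.pow.dvd_of_dvd_mul_left (Dvd.intro _ key.symm)
  have h₂ : β ^ 2 - X ^ 2 * γ ^ 2 = δ ^ 2 * f :=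
    mul_left_cancel₀ (pow_ne_zero 2 hα) (by rw [← key, h₁]; ring)
  -- Adding the two equations gives `f * (α² + δ²) = γ² * (1 - X²)`, where `f` is coprime to `γ`.
  have hfγ : IsCoprime f (γ ^ 2) := by
    have h : IsCoprime (γ ^ 2 - β ^ 2) (γ ^ 2) := by
      simpa [sub_eq_neg_add] using hγβ.symm.pow.neg_left.add_mul_right_left 1
    exact h.of_isCoprime_of_dvd_left (h₁ ▸ dvd_mul_left _ _)
  have hf : f ∣ X ^ 2 - 1 := hfγ.dvd_of_dvd_mul_right
    ⟨-(α ^ 2 + δ ^ 2), by linear_combination -h₁ - h₂⟩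
  have hdeg : e.natDegree = α.natDegree + γ.natDegree + (β.natDegree + δ.natDegree) := by
    rw [heuv, natDegree_mul (mul_ne_zero hα hγ) (mul_ne_zero hβ hδ), natDegree_mul hα hγ,
      natDegree_mul hβ hδ]
  -- If `f` is a constant, `(i β, γ)` is a smaller solution; if `f` is a multiple of `X² - 1`, solving
  -- the two equations for `γ²` and `β²` shows that `(δ, α)` is one.
  rcases dvd_X_sq_sub_one_cases hf with h | ⟨d, hd, rfl | rfl⟩
  · exact not_odd_natDegree_of_sq_mul hα hγ hδ h₁ h₂ (h ▸ odd_one)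
  · refine ih _ ?_ ((isCoprime_mul_unit_left_left hI0 β γ).mpr hγβ.symm)
      (mul_ne_zero hI0.ne_zero hβ) hγ (s := C d * α) (t := C i * (C d * δ)) ?_ ?_ rfl
    · rw [natDegree_C_mul (by rintro rfl; simp at hi)]; lia
    · linear_combination h₁ + β ^ 2 * hI
    · linear_combination (β ^ 2 - C d ^ 2 * δ ^ 2) * hI - h₂
  · have hX₁ : (X ^ 2 - 1 : k[X]) ≠ 0 := X_pow_sub_C_ne_zero two_pos (1 : k)
    have hD : (C d⁻¹ * C d : k[X]) = 1 := by rw [← C_mul, inv_mul_cancel₀ hd, C_1]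
    have hγ' : γ ^ 2 = -(C d ^ 2 * (δ ^ 2 + α ^ 2)) :=
      mul_left_cancel₀ hX₁ (by linear_combination -h₁ - h₂)
    have hβ' : β ^ 2 = -(C d ^ 2 * (δ ^ 2 + X ^ 2 * α ^ 2)) :=
      mul_left_cancel₀ hX₁ (by linear_combination -X ^ 2 * h₁ - h₂)
    have hsq : ∀ a g : k[X], g ^ 2 = -(C d ^ 2 * a) → a = (C i * (C d⁻¹ * g)) ^ 2 := fun a g h => by
      rw [mul_pow, mul_pow, hI, h]
      linear_combination -a * (C d⁻¹ * C d + 1) * hD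
    refine ih _ ?_ hαδ.symm hδ hα (hsq _ _ hγ') (hsq _ _ hβ') rfl
    lia

end Descent

/-! ### The rational points -/

namespace MordellWeilFamily

/-- Clearing the denominator of `w` turns a square in `ℚ(T)` into a square in `ℚ[T]`, which is
integrally closed. -/
lemma exists_num_sq_add_eq_sq (w a : K) (p : ℚ[X])
    (h : w ^ 2 + algebraMap ℚ[X] K p ^ 2 = a ^ 2) :
    ∃ s : ℚ[X], w.num ^ 2 + p ^ 2 * w.denom ^ 2 = s ^ 2 := by
  have hd : algebraMap ℚ[X] K w.denom ≠ 0 := RatFunc.algebraMap_ne_zero w.denom_ne_zero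
  have hw : w * algebraMap ℚ[X] K w.denom = algebraMap ℚ[X] K w.num := by
    rw [← eq_div_iff hd, RatFunc.num_div_denom]
  have hsq : algebraMap ℚ[X] K (w.num ^ 2 + p ^ 2 * w.denom ^ 2) =
      (a * algebraMap ℚ[X] K w.denom) ^ 2 := by
    simp only [map_add, map_mul, map_pow, ← hw]
    linear_combination algebraMap ℚ[X] K w.denom ^ 2 * h
  obtain ⟨s, hs⟩ := IsIntegrallyClosed.exists_algebraMap_eq_of_isIntegral_pow (R := ℚ[X]) two_pos
    (hsq ▸ isIntegral_algebraMap)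
  refine ⟨s, RatFunc.algebraMap_injective ℚ ?_⟩
  rw [hsq, map_pow, hs]

/-- The only `w ∈ ℚ(T)` for which `w² + 1` and `w² + T²` are squares is `w = 0`. -/
lemma eq_zero_of_sq_add_eq_sq {w a b : K} (ha : w ^ 2 + 1 = a ^ 2) (hb : w ^ 2 + T ^ 2 = b ^ 2) :
    w = 0 := by
  by_contra hw
  obtain ⟨s, hs⟩ := exists_num_sq_add_eq_sq w a 1 (by simpa using ha)
  obtain ⟨t, ht⟩ := exists_num_sq_add_eq_sq w b X (by simpa using hb)
  let φ : ℚ[X] →+* (AlgebraicClosure ℚ)[X] := mapRingHom (algebraMap ℚ (AlgebraicClosure ℚ))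
  have hφ : Function.Injective φ := map_injective _ (algebraMap ℚ (AlgebraicClosure ℚ)).injective
  refine not_sq_add_sq_of_isCoprime (r := φ w.num) (e := φ w.denom) (s := φ s) (t := φ t)
    (w.isCoprime_num_denom.map φ) ((map_ne_zero_iff φ hφ).mpr (RatFunc.num_ne_zero hw))
    ((map_ne_zero_iff φ hφ).mpr w.denom_ne_zero) ?_ ?_
  · simpa using congrArg φ hs
  · simpa [φ] using congrArg φ ht

/-- If `y ≠ 0`, the double of `(x, y)` has first coordinate `w²` with `w = (x² - T²) / (2y)`, and
`w² + 1`, `w² + T²` are squares as well. -/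
lemma sq_eq_T_sq {x y : K} (h : y ^ 2 = x * (x + 1) * (x + T ^ 2)) (hy : y ≠ 0) :
    x ^ 2 = T ^ 2 := by
  have hw : (x ^ 2 - T ^ 2) / (2 * y) = 0 := by
    refine eq_zero_of_sq_add_eq_sq (a := (x ^ 2 + 2 * x + T ^ 2) / (2 * y))
      (b := (x ^ 2 + 2 * T ^ 2 * x + T ^ 2) / (2 * y)) ?_ ?_
    · field_simp
      linear_combination 4 * h
    · field_simp
      linear_combination 4 * T ^ 2 * h
  rcases div_eq_zero_iff.mp hw with h0 | h0
  · linear_combination h0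
  · exact absurd h0 (mul_ne_zero two_ne_zero hy)

lemma pt_congr {x x' y y' : K} (hx : x = x') (hy : y = y') (h) (h') : pt x y h = pt x' y' h' := by
  subst hx hy; rfl

lemma mem_eightPoints (P : E.toAffine.Point) : P ∈ eightPoints := by
  rcases P with _ | ⟨x, y, hP⟩
  · exact .inl rfl
  have h := (equation_iff x y).mp hP.1
  change pt x y h ∈ eightPoints
  simp only [eightPoints, Set.mem_insert_iff, Set.mem_singleton_iff]
  by_cases hy : y = 0
  · have h0 : x * (x + 1) * (x + T ^ 2) = 0 := by rw [← h, hy]; ring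
    rcases mul_eq_zero.mp h0 with h0 | h0
    · rcases mul_eq_zero.mp h0 with h0 | h0
      · exact .inr (.inr (.inl (pt_congr h0 hy _ _)))
      · exact .inr (.inr (.inr (.inr (.inl (pt_congr (eq_neg_of_add_eq_zero_left h0) hy _ _)))))
    · exact .inr (.inr (.inr (.inr (.inr (.inr (.inl
        (pt_congr (by linear_combination h0) hy _ _)))))))
  · rcases sq_eq_sq_iff_eq_or_eq_neg.mp (sq_eq_T_sq h hy) with rfl | rfl
    · rcases sq_eq_sq_iff_eq_or_eq_neg.mp (h.trans (by ring : _ = (T * (T + 1)) ^ 2)) with h0 | h0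
      · exact .inr (.inr (.inr (.inr (.inr (.inr (.inr (pt_congr rfl h0 _ _)))))))
      · exact .inr (.inr (.inr (.inr (.inr (.inl (pt_congr rfl h0 _ _))))))
    · rcases sq_eq_sq_iff_eq_or_eq_neg.mp (h.trans (by ring : _ = (T * (T - 1)) ^ 2)) with h0 | h0
      · exact .inr (.inr (.inr (.inl (pt_congr rfl h0 _ _))))
      · exact .inr (.inl (pt_congr rfl h0 _ _))

theorem univ_eq_eightPoints : (Set.univ : Set E.toAffine.Point) = eightPoints :=
  (Set.eq_univ_of_forall mem_eightPoints).symm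

lemma pt_ne_zero {x y : K} (h) : pt x y h ≠ 0 := WeierstrassCurve.Affine.Point.some_ne_zero _

lemma pt_ne_pt {x x' y y' : K} (hx : x ≠ x') (h) (h') : pt x y h ≠ pt x' y' h' := fun he =>
  hx (WeierstrassCurve.Affine.Point.some.inj he).1

lemma two_nsmul_pt_of_eq_zero [DecidableEq (RatFunc ℚ)] {x : K} (h) : 2 • pt x 0 h = 0 := by
  rw [two_nsmul]
  exact WeierstrassCurve.Affine.Point.add_self_of_Y_eq (by simp [E])

/-- The tangent at `(T, T(T + 1))` has slope `T + 1` and passes through `(0, 0)`. -/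
lemma two_nsmul_pt_T [DecidableEq (RatFunc ℚ)] :
    2 • pt T (T * (T + 1)) (by ring) = pt 0 0 (by ring) := by
  have h1 : T + 1 ≠ 0 := by simpa using T_add_C_ne_zero 1
  have hT : T ≠ 0 := RatFunc.X_ne_zero
  have hy : T * (T + 1) ≠ E.toAffine.negY T (T * (T + 1)) := by
    simp only [WeierstrassCurve.Affine.negY, E]
    intro h
    refine mul_ne_zero (two_ne_zero (α := K)) (mul_ne_zero hT h1) ?_
    linear_combination h
  have hs : E.toAffine.slope T T (T * (T + 1)) (T * (T + 1)) = T + 1 := by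
    rw [WeierstrassCurve.Affine.slope_of_Y_ne rfl hy, div_eq_iff (sub_ne_zero.mpr hy)]
    simp only [WeierstrassCurve.Affine.negY, E]
    ring
  rw [two_nsmul]
  refine (WeierstrassCurve.Affine.Point.add_self_of_Y_ne hy).trans ?_
  have hX : E.toAffine.addX T T (T + 1) = 0 := by
    simp only [WeierstrassCurve.Affine.addX, E]
    ring
  have hY : E.toAffine.addY T T (T * (T + 1)) (T + 1) = 0 := by
    rw [WeierstrassCurve.Affine.addY, WeierstrassCurve.Affine.negAddY, hX]
    simp only [WeierstrassCurve.Affine.negY, E]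
    ring
  simp only [hs, hX, hY, pt]

end MordellWeilFamily

/-! ### The group structure -/

/-- Elements `R` of order 2 and `Q` of order 4 with `R ≠ 2Q` generate a copy of
`ℤ/2 × ℤ/4`. -/
lemma exists_injective_zmod_two_prod_zmod_four {A : Type*} [AddCommGroup A] {R Q : A}
    (hR : 2 • R = 0) (hQ : 4 • Q = 0) (hR₀ : R ≠ 0) (hQ₂ : 2 • Q ≠ 0) (hRQ : R ≠ 2 • Q) :
    ∃ f : ZMod 2 × ZMod 4 →+ A, Function.Injective f := by
  let g₂ : ZMod 2 →+ A := ZMod.lift 2 ⟨zmultiplesHom A R, by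
    rw [zmultiplesHom_apply, natCast_zsmul, hR]⟩
  let g₄ : ZMod 4 →+ A := ZMod.lift 4 ⟨zmultiplesHom A Q, by
    rw [zmultiplesHom_apply, natCast_zsmul, hQ]⟩
  have h₂ (n : ℕ) : g₂ n = n • R := by
    simpa using ZMod.lift_coe 2 ⟨zmultiplesHom A R, _⟩ (n : ℤ)
  have h₄ (n : ℕ) : g₄ n = n • Q := by
    simpa using ZMod.lift_coe 4 ⟨zmultiplesHom A Q, _⟩ (n : ℤ)
  refine ⟨g₂.coprod g₄, (injective_iff_map_eq_zero _).mpr ?_⟩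
  rintro ⟨a, b⟩ h
  rw [AddMonoidHom.coprod_apply, ← ZMod.natCast_zmod_val a, ← ZMod.natCast_zmod_val b, h₂, h₄] at h
  -- In the odd cases doubling the relation `h` gives `2 • Q = 0`.
  fin_cases a <;> fin_cases b <;> simp [ZMod.val] at h
  · rfl
  · exact absurd (by rw [h, smul_zero]) hQ₂
  · exact absurd h hQ₂
  · exact absurd (by rw [show 2 • Q = 2 • 3 • Q - 4 • Q by abel, h, hQ, smul_zero, sub_zero]) hQ₂
  · exact absurd h hR₀
  · exact absurd (by
      rw [show 2 • Q = 2 • (R + Q) - 2 • R by abel, h, hR, smul_zero, sub_zero]) hQ₂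
  · exact absurd (by
      rw [← sub_eq_zero, show R - 2 • Q = R + 2 • Q - 4 • Q by abel, h, hQ, sub_zero]) hRQ
  · exact absurd (by
      rw [show 2 • Q = 2 • (R + 3 • Q) - 2 • R - 4 • Q by abel, h, hR, hQ, smul_zero, sub_zero,
        sub_zero]) hQ₂

namespace MordellWeilFamily

lemma card_le_eight : Nat.card E.toAffine.Point ≤ 8 := by
  rw [← Set.ncard_univ, univ_eq_eightPoints, eightPoints]
  iterate 7 refine (Set.ncard_insert_le _ _).trans (Nat.succ_le_succ ?_)
  rw [Set.ncard_singleton]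

lemma finite_point : Finite E.toAffine.Point := by
  rw [← Set.finite_univ_iff, univ_eq_eightPoints, eightPoints]
  exact Set.toFinite _

end MordellWeilFamily

theorem mainTheorem6 [DecidableEq (RatFunc ℚ)] :
    Nonempty (MordellWeilFamily.E.toAffine.Point ≃+ ZMod 2 × ZMod 4) ∧
      (Set.univ : Set MordellWeilFamily.E.toAffine.Point) = MordellWeilFamily.eightPoints := by
  open MordellWeilFamily in
  refine ⟨?_, univ_eq_eightPoints⟩
  have hT : (0 : K) ≠ -1 := by norm_num
  obtain ⟨f, hf⟩ := exists_injective_zmod_two_prod_zmod_four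
    (R := pt (-1) 0 (by ring)) (Q := pt T (T * (T + 1)) (by ring))
    (two_nsmul_pt_of_eq_zero _)
    (by rw [show 4 = 2 * 2 from rfl, mul_nsmul, two_nsmul_pt_T, two_nsmul_pt_of_eq_zero])
    (pt_ne_zero _) (two_nsmul_pt_T ▸ pt_ne_zero _) (two_nsmul_pt_T ▸ pt_ne_pt hT.symm _ _)
  have := finite_point
  exact ⟨(AddEquiv.ofBijective f (hf.bijective_of_nat_card_le
    (card_le_eight.trans (by simp)))).symm⟩
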